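/- All graphs are finite and simple. An edge-coloring of a graph $G$ with colors $1,\ldots,t$ is an interval $t$-coloring if all $t$ colors are used, and at each vertex of $G$ the incident edges have pairwise distinct colors that form an interval of integers. For $n_1,n_2\geq 3$ let $T(n_1,n_2)=C_{n_1}\square C_{n_2}$ denote the torus, the Cartesian product of the simple cycles of lengths $n_1$ and $n_2$. Then the following hold for integers $m,n,t$. (1) If $m\geq 2$, $n\geq 2$ and $4\leq t\leq \max\{3m+n+2,\,3n+m+2\}$, then $T(2m,2n)$ has an interval $t$-coloring. (2) If $m\geq 2$ is odd, $n\geq 1$ and $4\leq t\leq 2m+2n+2$, then $T(2m,2n+1)$ has an interval $t$-coloring. (3) If $m\geq 2$ is even, $n\geq 1$ and $4\leq t\leq 2m+2n+3$, then $T(2m,2n+1)$ has an interval $t$-coloring. -/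

import Mathlib

/-- The torus `T(n₁, n₂)`: the Cartesian product `C_{n₁} □ C_{n₂}` of two cycles. -/
def torus (n₁ n₂ : ℕ) : SimpleGraph (Fin n₁ × Fin n₂) :=
  SimpleGraph.boxProd (SimpleGraph.cycleGraph n₁) (SimpleGraph.cycleGraph n₂)

/-- The set of edges of `G` incident to the vertex `v`. -/
def edgesAt {V : Type*} (G : SimpleGraph V) (v : V) : Set G.edgeSet :=
  {e | v ∈ (e : Sym2 V)}

/-- `α` is an interval `t`-coloring of `G`: it colors the edges with the colors `1, …, t`, all of
these colors are used, and at each vertex the incident edges have pairwise distinct colors, which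
form an interval of integers. -/
structure IsIntervalColoring {V : Type*} (G : SimpleGraph V) (t : ℕ) (α : G.edgeSet → ℕ) :
    Prop where
  /-- The colors are `1, …, t`, and all of them are used. -/
  range_eq : Set.range α = Set.Icc 1 t
  /-- Distinct edges at a vertex have distinct colors. -/
  injOn : ∀ v : V, Set.InjOn α (edgesAt G v)
  /-- The colors at a vertex form an interval of integers (empty at an isolated vertex). -/
  interval : ∀ v : V, ∃ a b : ℕ, α '' edgesAt G v = Set.Icc a b

/-- `G` has an interval `t`-coloring. -/
def HasIntervalColoring {V : Type*} (G : SimpleGraph V) (t : ℕ) : Prop :=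
  ∃ α : G.edgeSet → ℕ, IsIntervalColoring G t α

/-!
Three observations carry the proof.

*Lowering the number of colors.* If every spectrum (the set of colors at a vertex) is an interval of
`r + 1` consecutive integers, then a top color `t + 1 > r + 1` occurs only in spectra
`{t - r + 1, …, t + 1}`. Recoloring `t + 1` as `t - r` slides these spectra down by one and changes
nothing else (`IsUniformColoring.lower`). On a torus all spectra have four elements, so only the
largest `t` has to be attained.

*Connectivity.* On a connected graph the spectra of neighbours overlap, so every color between two
used ones is used (`IsUniformColoring.of_connected`). Only the extreme colors need to be exhibited.

*Patterns with many colors.* On `C_{2m} □ C_{2n}` (`evenTorusPattern`) take the coloring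
`0, 1, …, n, n - 1, …, 1` of `C_{2n}` in every column, shifted by about `3` from each column to the
next in both directions away from column `0`; the horizontal edges of column `0` lie above its
vertical edges, those of the antipodal column `m` lie below, and this gives `3m + n + 2` colors.
On `C_{2m} □ C_{2n+1}` (`oddTorusPattern`) pair the columns into `m` prisms `K₂ □ C_{2n+1}`, color
each prism with `2n + 3` colors so that the two ends of a rung have the same spectrum, and shift
consecutive prisms by `4` in both directions away from the first; an edge between two prisms
receives the color just above the spectrum of the lower one. The antipode of the first prism is a
single prism when `m` is even and a pair of joined prisms when `m` is odd, hence the two bounds.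
-/

/-! ### Colorings whose spectra all have the same size -/

/-- `α` uses exactly the colors `1, …, t`, it is a proper edge coloring, and the colors at each
vertex are `r + 1` consecutive integers. -/
structure IsUniformColoring {V : Type*} (G : SimpleGraph V) (r t : ℕ) (α : G.edgeSet → ℕ) :
    Prop where
  range_eq : Set.range α = Set.Icc 1 t
  injOn : ∀ v : V, Set.InjOn α (edgesAt G v)
  interval : ∀ v : V, ∃ a : ℕ, α '' edgesAt G v = Set.Icc a (a + r)

namespace IsUniformColoring

variable {V : Type*} {G : SimpleGraph V} {r t : ℕ} {α : G.edgeSet → ℕ}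

theorem isIntervalColoring (h : IsUniformColoring G r t α) : IsIntervalColoring G t α :=
  ⟨h.range_eq, h.injOn, fun v => let ⟨a, ha⟩ := h.interval v; ⟨a, a + r, ha⟩⟩

/-- Recoloring the edges of color `t + 1` with `t - r` removes the top color. -/
theorem lower (hr : r < t) (h : IsUniformColoring G r (t + 1) α) :
    IsUniformColoring G r t (fun e => if α e = t + 1 then t - r else α e) := by
  have hmem : ∀ e, 1 ≤ α e ∧ α e ≤ t + 1 := fun e => by
    have : α e ∈ Set.Icc 1 (t + 1) := h.range_eq ▸ Set.mem_range_self e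
    exact this
  -- A spectrum containing `t + 1` is `{t + 1 - r, …, t + 1}`, so it avoids `t - r`.
  have avoid : ∀ v, ∀ e ∈ edgesAt G v, ∀ e' ∈ edgesAt G v, α e = t + 1 → α e' ≠ t - r := by
    intro v e he e' he' h1 h2
    obtain ⟨a, ha⟩ := h.interval v
    have h3 : α e ∈ Set.Icc a (a + r) := ha ▸ Set.mem_image_of_mem α he
    have h4 : α e' ∈ Set.Icc a (a + r) := ha ▸ Set.mem_image_of_mem α he'
    simp only [Set.mem_Icc] at h3 h4
    omega
  refine ⟨?_, ?_, ?_⟩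
  · ext c
    simp only [Set.mem_range, Set.mem_Icc]
    constructor
    · rintro ⟨e, rfl⟩
      have := hmem e
      split_ifs <;> omega
    · rintro ⟨h1, h2⟩
      have hc : c ∈ Set.range α := by
        rw [h.range_eq]
        exact ⟨h1, by omega⟩
      obtain ⟨e, rfl⟩ := hc
      exact ⟨e, if_neg (by omega)⟩
  · intro v e he e' he' hee
    dsimp only at hee
    have h1 := avoid v e he e' he'
    have h2 := avoid v e' he' e he
    apply h.injOn v he he'
    split_ifs at hee with h3 h4 h4
    · rw [h3, h4]
    · exact absurd hee.symm (h1 h3)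
    · exact absurd hee (h2 h4)
    · exact hee
  · intro v
    obtain ⟨a, ha⟩ := h.interval v
    have hin : ∀ c, c ∈ Set.Icc a (a + r) → ∃ e ∈ edgesAt G v, α e = c := fun c hc => by
      rw [← ha] at hc
      exact hc
    have hout : ∀ e ∈ edgesAt G v, a ≤ α e ∧ α e ≤ a + r := fun e he => by
      have : α e ∈ Set.Icc a (a + r) := ha ▸ Set.mem_image_of_mem α he
      exact this
    obtain ⟨etop, hetop, htop⟩ := hin (a + r) ⟨by omega, le_rfl⟩
    have hle := (hmem etop).2
    by_cases hat : a + r = t + 1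
    · refine ⟨t - r, ?_⟩
      ext c
      simp only [Set.mem_image, Set.mem_Icc]
      constructor
      · rintro ⟨e, he, rfl⟩
        have := hout e he
        split_ifs <;> omega
      · rintro ⟨h1, h2⟩
        by_cases hc : c = t - r
        · exact ⟨etop, hetop, by rw [if_pos (by omega), hc]⟩
        · obtain ⟨e, he, rfl⟩ := hin c ⟨by omega, by omega⟩
          exact ⟨e, he, if_neg (by omega)⟩
    · refine ⟨a, ?_⟩
      rw [← ha]
      refine Set.image_congr fun e he => if_neg ?_
      have := hout e he
      omega

theorem exists_of_le (h : IsUniformColoring G r t α) {s : ℕ} (hs : r < s) (hst : s ≤ t) :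
    ∃ β, IsUniformColoring G r s β := by
  induction t, hst using Nat.le_induction generalizing α with
  | base => exact ⟨α, h⟩
  | succ t hst ih => exact ih (h.lower (by omega))

/-- On a connected graph, the lowest and the highest color force all colors in between: a missing
color `c` would separate the vertices with spectrum below `c` from those with spectrum above. -/
theorem of_connected (hG : G.Connected) (hinj : ∀ v, Set.InjOn α (edgesAt G v))
    (hint : ∀ v, ∃ a : ℕ, α '' edgesAt G v = Set.Icc a (a + r))
    (hmem : ∀ e, 1 ≤ α e ∧ α e ≤ t) (hone : ∃ e, α e = 1) (htop : ∃ e, α e = t) :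
    IsUniformColoring G r t α := by
  refine ⟨?_, hinj, hint⟩
  ext c
  refine ⟨fun ⟨e, he⟩ => he ▸ hmem e, fun ⟨h1, h2⟩ => ?_⟩
  by_contra hc
  choose a ha using hint
  have hout : ∀ v, ∀ e ∈ edgesAt G v, a v ≤ α e ∧ α e ≤ a v + r := fun v e he => by
    have : α e ∈ Set.Icc (a v) (a v + r) := ha v ▸ Set.mem_image_of_mem α he
    exact this
  have hsep : ∀ v, c < a v ∨ a v + r < c := by
    intro v
    by_contra! hv
    have : c ∈ α '' edgesAt G v := by
      rw [ha v]
      exact hv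
    obtain ⟨e, -, he⟩ := this
    exact hc ⟨e, he⟩
  have hstep : ∀ u v, G.Adj u v → a u < c → a v < c := by
    intro u v huv hu
    have h3 := hout u ⟨s(u, v), huv⟩ (Sym2.mem_mk_left u v)
    have h4 := hout v ⟨s(u, v), huv⟩ (Sym2.mem_mk_right u v)
    have := hsep u
    omega
  have hreach : ∀ u v, a u < c → a v < c := by
    intro u v hu
    obtain ⟨w⟩ := hG.preconnected u v
    induction w with
    | nil => exact hu
    | cons huv _ ih => exact ih (hstep _ _ huv hu)
  have hend : ∀ e : G.edgeSet, ∃ v, e ∈ edgesAt G v := by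
    rintro ⟨e, he⟩
    induction e with
    | h u v => exact ⟨u, Sym2.mem_mk_left u v⟩
  obtain ⟨e, he⟩ := hone
  obtain ⟨e', he'⟩ := htop
  obtain ⟨u, hu⟩ := hend e
  obtain ⟨v, hv⟩ := hend e'
  have h3 := hout u e hu
  have h4 := hout v e' hv
  have h5 := hreach u v
  have h6 := hsep u
  have h7 := hsep v
  omega

end IsUniformColoring

/-! ### Edge patterns on a torus -/

/-- `p, q, r, s` are the integers `a, a + 1, a + 2, a + 3` in some order. -/
def AreConsecutive (a p q r s : ℕ) : Prop :=
  (p ≠ q ∧ p ≠ r ∧ p ≠ s ∧ q ≠ r ∧ q ≠ s ∧ r ≠ s) ∧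
    (a ≤ p ∧ p ≤ a + 3) ∧ (a ≤ q ∧ q ≤ a + 3) ∧ (a ≤ r ∧ r ≤ a + 3) ∧ (a ≤ s ∧ s ≤ a + 3)

/-- An interval `t`-coloring of `torus M N` in coordinates: `H i j` is the color of the edge from
`(i, j)` to `(i + 1, j)` and `V i j` that of the edge from `(i, j)` to `(i, j + 1)`, indices being
cyclic. Only the extreme colors `1` and `t` are required to occur. -/
structure IsTorusPattern (M N t : ℕ) [NeZero M] [NeZero N] (H V : Fin M → Fin N → ℕ) : Prop where
  consecutive : ∀ i j, ∃ a, AreConsecutive a (H i j) (H (i - 1) j) (V i j) (V i (j - 1))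
  mem_H : ∀ i j, 1 ≤ H i j ∧ H i j ≤ t
  mem_V : ∀ i j, 1 ≤ V i j ∧ V i j ≤ t
  one : (∃ i j, H i j = 1) ∨ ∃ i j, V i j = 1
  top : (∃ i j, H i j = t) ∨ ∃ i j, V i j = t

theorem Fin.val_cyclic_succ {M : ℕ} [NeZero M] (hM : 3 ≤ M) (i : Fin M) :
    ((i + 1 : Fin M) : ℕ) = if (i : ℕ) + 1 = M then 0 else (i : ℕ) + 1 := by
  have hi := i.isLt
  rw [Fin.val_add, Fin.val_one', Nat.mod_eq_of_lt (show 1 < M by omega)]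
  split_ifs with h
  · rw [h, Nat.mod_self]
  · exact Nat.mod_eq_of_lt (by omega)

theorem Fin.val_cyclic_pred {M : ℕ} [NeZero M] (hM : 3 ≤ M) (i : Fin M) :
    ((i - 1 : Fin M) : ℕ) = if (i : ℕ) = 0 then M - 1 else (i : ℕ) - 1 := by
  have h := Fin.val_cyclic_succ hM (i - 1)
  rw [sub_add_cancel] at h
  have := (i - 1).isLt
  split_ifs at h ⊢ <;> omega

theorem cycleGraph_adj_iff_cyclic {M : ℕ} [NeZero M] (hM : 3 ≤ M) (i k : Fin M) :
    (SimpleGraph.cycleGraph M).Adj i k ↔ k = i + 1 ∨ k = i - 1 := by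
  obtain ⟨M, rfl⟩ : ∃ k, M = k + 2 := ⟨M - 2, by omega⟩
  rw [SimpleGraph.cycleGraph_adj, or_comm, sub_eq_iff_eq_add, sub_eq_iff_eq_add, eq_sub_iff_add_eq,
    add_comm 1 i, add_comm 1 k, eq_comm (a := i)]

section
variable {M N t : ℕ} [NeZero M] [NeZero N]

theorem torus_adj_iff (hM : 3 ≤ M) (hN : 3 ≤ N) (i : Fin M) (j : Fin N) (w : Fin M × Fin N) :
    (torus M N).Adj (i, j) w ↔ w = (i + 1, j) ∨ w = (i - 1, j) ∨ w = (i, j + 1) ∨ w = (i, j - 1) := by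
  obtain ⟨k, l⟩ := w
  simp only [torus, SimpleGraph.boxProd_adj, cycleGraph_adj_iff_cyclic hM,
    cycleGraph_adj_iff_cyclic hN, Prod.mk.injEq, eq_comm (a := j) (b := l), eq_comm (a := i) (b := k)]
  tauto

theorem torus_connected : (torus M N).Connected := by
  obtain ⟨M, rfl⟩ := Nat.exists_eq_succ_of_ne_zero (NeZero.ne M)
  obtain ⟨N, rfl⟩ := Nat.exists_eq_succ_of_ne_zero (NeZero.ne N)
  exact SimpleGraph.cycleGraph_connected.boxProd SimpleGraph.cycleGraph_connected

/-- The color that `H` and `V` give to the edge `s(u, w)`. For adjacent `u` and `w`, and side lengths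
at least `3`, exactly one of the four conditions holds; writing the color as a sum makes the symmetry
in `u` and `w` evident, for all `u` and `w`. -/
def patternColor (H V : Fin M → Fin N → ℕ) (u w : Fin M × Fin N) : ℕ :=
  ((if w = (u.1 + 1, u.2) then H u.1 u.2 else 0) + if w = (u.1, u.2 + 1) then V u.1 u.2 else 0) +
    ((if u = (w.1 + 1, w.2) then H w.1 w.2 else 0) + if u = (w.1, w.2 + 1) then V w.1 w.2 else 0)

/-- The edge coloring of the torus given by `H` and `V`. -/
def patternColoring (H V : Fin M → Fin N → ℕ) (e : (torus M N).edgeSet) : ℕ :=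
  Sym2.lift ⟨patternColor H V, fun _ _ => add_comm _ _⟩ (e : Sym2 (Fin M × Fin N))

theorem patternColor_neighbors (hM : 3 ≤ M) (hN : 3 ≤ N) (H V : Fin M → Fin N → ℕ) (i : Fin M)
    (j : Fin N) :
    patternColor H V (i, j) (i + 1, j) = H i j ∧
      patternColor H V (i, j) (i - 1, j) = H (i - 1) j ∧
      patternColor H V (i, j) (i, j + 1) = V i j ∧
      patternColor H V (i, j) (i, j - 1) = V i (j - 1) := by
  have h1 := Fin.val_cyclic_succ hM i
  have h2 := Fin.val_cyclic_pred hM i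
  have h3 := Fin.val_cyclic_succ hM (i + 1)
  have h5 := Fin.val_cyclic_succ hN j
  have h6 := Fin.val_cyclic_pred hN j
  have h7 := Fin.val_cyclic_succ hN (j + 1)
  have hi := i.isLt
  have hj := j.isLt
  have n1 : i + 1 ≠ i := fun h => by
    rw [Fin.ext_iff] at h; split_ifs at h1 <;> omega
  have n2 : i - 1 ≠ i + 1 := fun h => by
    rw [Fin.ext_iff] at h; split_ifs at h1 h2 <;> omega
  have n3 : i ≠ i + 1 + 1 := fun h => by
    rw [Fin.ext_iff] at h; split_ifs at h1 h3 <;> omega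
  have n4 : i - 1 ≠ i := fun h => by
    rw [Fin.ext_iff] at h; split_ifs at h2 <;> omega
  have m1 : j + 1 ≠ j := fun h => by
    rw [Fin.ext_iff] at h; split_ifs at h5 <;> omega
  have m2 : j - 1 ≠ j + 1 := fun h => by
    rw [Fin.ext_iff] at h; split_ifs at h5 h6 <;> omega
  have m3 : j ≠ j + 1 + 1 := fun h => by
    rw [Fin.ext_iff] at h; split_ifs at h5 h7 <;> omega
  have m4 : j - 1 ≠ j := fun h => by
    rw [Fin.ext_iff] at h; split_ifs at h6 <;> omega
  simp only [patternColor, Prod.mk.injEq, sub_add_cancel, n1, n1.symm, n2, n3, n4, n4.symm, m1,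
    m1.symm, m2, m3, m4, m4.symm, and_true, and_false, if_true, if_false, and_self,
    add_zero, zero_add]

/-- A pattern yields a coloring all of whose spectra consist of four consecutive colors. -/
theorem IsTorusPattern.isUniformColoring (hM : 3 ≤ M) (hN : 3 ≤ N) {H V : Fin M → Fin N → ℕ}
    (h : IsTorusPattern M N t H V) : IsUniformColoring (torus M N) 3 t (patternColoring H V) := by
  have hmk : ∀ u w (huw : s(u, w) ∈ (torus M N).edgeSet),
      patternColoring H V ⟨s(u, w), huw⟩ = patternColor H V u w := fun _ _ _ => rfl
  have hadj : ∀ i j w, (torus M N).Adj (i, j) w ↔ _ := torus_adj_iff hM hN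
  have hcol := patternColor_neighbors hM hN H V
  have hedge : ∀ i j, ∀ e ∈ edgesAt (torus M N) (i, j), ∃ w,
      ∃ hw : s((i, j), w) ∈ (torus M N).edgeSet, e = ⟨s((i, j), w), hw⟩ := by
    rintro i j ⟨e, he⟩ hv
    obtain ⟨w, rfl⟩ := Sym2.mem_iff_exists.mp hv
    exact ⟨w, he, rfl⟩
  have hH : ∀ i j, ∃ e, patternColoring H V e = H i j := fun i j =>
    ⟨⟨s((i, j), (i + 1, j)), (hadj i j _).2 (by simp)⟩, (hcol i j).1⟩
  have hV : ∀ i j, ∃ e, patternColoring H V e = V i j := fun i j =>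
    ⟨⟨s((i, j), (i, j + 1)), (hadj i j _).2 (by simp)⟩, (hcol i j).2.2.1⟩
  refine IsUniformColoring.of_connected torus_connected ?_ ?_ ?_ ?_ ?_
  · rintro ⟨i, j⟩ e he e' he' hee
    obtain ⟨w, hw, rfl⟩ := hedge i j e he
    obtain ⟨w', hw', rfl⟩ := hedge i j e' he'
    obtain ⟨a, ⟨d1, d2, d3, d4, d5, d6⟩, -⟩ := h.consecutive i j
    obtain ⟨c1, c2, c3, c4⟩ := hcol i j
    rw [hmk, hmk] at hee
    have : w = w' := by
      rcases (hadj i j w).1 hw with rfl | rfl | rfl | rfl <;>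
        rcases (hadj i j w').1 hw' with rfl | rfl | rfl | rfl <;>
        first
        | rfl
        | (simp only [c1, c2, c3, c4] at hee; omega)
    subst this
    rfl
  · rintro ⟨i, j⟩
    obtain ⟨a, ha⟩ := h.consecutive i j
    obtain ⟨c1, c2, c3, c4⟩ := hcol i j
    refine ⟨a, ?_⟩
    have himg : patternColoring H V '' edgesAt (torus M N) (i, j) =
        {H i j, H (i - 1) j, V i j, V i (j - 1)} := by
      ext c
      simp only [Set.mem_image, Set.mem_insert_iff, Set.mem_singleton_iff]
      constructor
      · rintro ⟨e, he, rfl⟩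
        obtain ⟨w, hw, rfl⟩ := hedge i j e he
        rw [hmk]
        rcases (hadj i j w).1 hw with rfl | rfl | rfl | rfl
        · exact Or.inl c1
        · exact Or.inr (Or.inl c2)
        · exact Or.inr (Or.inr (Or.inl c3))
        · exact Or.inr (Or.inr (Or.inr c4))
      · rintro (rfl | rfl | rfl | rfl)
        · exact ⟨⟨s((i, j), (i + 1, j)), (hadj i j _).2 (by simp)⟩, Sym2.mem_mk_left _ _, c1⟩
        · exact ⟨⟨s((i, j), (i - 1, j)), (hadj i j _).2 (by simp)⟩, Sym2.mem_mk_left _ _, c2⟩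
        · exact ⟨⟨s((i, j), (i, j + 1)), (hadj i j _).2 (by simp)⟩, Sym2.mem_mk_left _ _, c3⟩
        · exact ⟨⟨s((i, j), (i, j - 1)), (hadj i j _).2 (by simp)⟩, Sym2.mem_mk_left _ _, c4⟩
    rw [himg]
    ext c
    simp only [Set.mem_insert_iff, Set.mem_singleton_iff, Set.mem_Icc]
    unfold AreConsecutive at ha
    omega
  · rintro ⟨e, he⟩
    induction e with
    | h u w =>
      obtain ⟨i, j⟩ := u
      obtain ⟨c1, c2, c3, c4⟩ := hcol i j
      rw [hmk]
      rcases (hadj i j w).1 he with rfl | rfl | rfl | rfl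
      · rw [c1]; exact h.mem_H _ _
      · rw [c2]; exact h.mem_H _ _
      · rw [c3]; exact h.mem_V _ _
      · rw [c4]; exact h.mem_V _ _
  · rcases h.one with ⟨i, j, hij⟩ | ⟨i, j, hij⟩
    · exact hij ▸ hH i j
    · exact hij ▸ hV i j
  · rcases h.top with ⟨i, j, hij⟩ | ⟨i, j, hij⟩
    · exact hij ▸ hH i j
    · exact hij ▸ hV i j

theorem IsTorusPattern.hasIntervalColoring (hM : 3 ≤ M) (hN : 3 ≤ N) {H V : Fin M → Fin N → ℕ}
    (h : IsTorusPattern M N t H V) {s : ℕ} (hs : 4 ≤ s) (hst : s ≤ t) :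
    HasIntervalColoring (torus M N) s :=
  let ⟨β, hβ⟩ := (h.isUniformColoring hM hN).exists_of_le hs hst
  ⟨β, hβ.isIntervalColoring⟩

theorem IsTorusPattern.swap {H V : Fin M → Fin N → ℕ} (h : IsTorusPattern M N t H V) :
    IsTorusPattern N M t (fun j i => V i j) (fun j i => H i j) where
  consecutive j i := by
    obtain ⟨a, ha⟩ := h.consecutive i j
    refine ⟨a, ?_⟩
    unfold AreConsecutive at ha ⊢
    omega
  mem_H j i := h.mem_V i j
  mem_V j i := h.mem_H i j
  one := h.one.symm.imp (fun ⟨i, j, e⟩ => ⟨j, i, e⟩) fun ⟨i, j, e⟩ => ⟨j, i, e⟩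
  top := h.top.symm.imp (fun ⟨i, j, e⟩ => ⟨j, i, e⟩) fun ⟨i, j, e⟩ => ⟨j, i, e⟩

end

/-! ### The product of two even cycles -/

/-- The colors of the horizontal edges of `C_{2m} □ C_{2n}`. The term `min (j - 1) (2 * n - j)` is
the lower of the two colors at the vertex `j` in the coloring `0, 1, …, n, n - 1, …, 1` of `C_{2n}`;
it is `0` at `j = 0` thanks to truncated subtraction. -/
def evenHorizontal (m n i j : ℕ) : ℕ :=
  min (j - 1) (2 * n - j) + (if i < m then 3 * i + 2 else 3 * (2 * m - 1 - i) + 3) + 1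

/-- The colors of the vertical edges of `C_{2m} □ C_{2n}`. -/
def evenVertical (m n i j : ℕ) : ℕ :=
  min j (2 * n - j) + (if i < m then 3 * i else 3 * (2 * m - i) + 1) + 1

theorem evenTorusPattern {m n : ℕ} (hm : 2 ≤ m) (hn : 2 ≤ n) [NeZero (2 * m)] [NeZero (2 * n)] :
    IsTorusPattern (2 * m) (2 * n) (3 * m + n + 2) (fun i j => evenHorizontal m n i j)
      (fun i j => evenVertical m n i j) where
  consecutive i j := by
    rw [Fin.val_cyclic_pred (by omega), Fin.val_cyclic_pred (by omega)]
    obtain ⟨i, hi⟩ := i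
    obtain ⟨j, hj⟩ := j
    dsimp only
    -- `low` is the lowest color at the vertex `j` of `C_{2n}`.
    obtain ⟨low, hlow⟩ : ∃ x, x = min (j - 1) (2 * n - j) := ⟨_, rfl⟩
    have hV : (min j (2 * n - j) = low ∧
          min (if j = 0 then 2 * n - 1 else j - 1)
            (2 * n - if j = 0 then 2 * n - 1 else j - 1) = low + 1) ∨
        (min j (2 * n - j) = low + 1 ∧
          min (if j = 0 then 2 * n - 1 else j - 1)
            (2 * n - if j = 0 then 2 * n - 1 else j - 1) = low) := by
      split_ifs <;> omega
    simp only [evenHorizontal, evenVertical, ← hlow]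
    generalize min j (2 * n - j) = p at hV
    generalize min (if j = 0 then 2 * n - 1 else j - 1)
      (2 * n - if j = 0 then 2 * n - 1 else j - 1) = q at hV
    refine ⟨low + 1 + if i = 0 then 0 else if i ≤ m then 3 * i - 1 else 3 * (2 * m - i), ?_⟩
    unfold AreConsecutive
    rcases Nat.eq_zero_or_pos i with rfl | hi0
    · simp only [if_true]
      split_ifs <;> omega
    · simp only [hi0.ne', if_false]
      split_ifs <;> omega
  mem_H i j := by
    have := i.isLt
    have := j.isLt
    unfold evenHorizontal
    split_ifs <;> omega
  mem_V i j := by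
    have := i.isLt
    have := j.isLt
    unfold evenVertical
    split_ifs <;> omega
  one := Or.inr ⟨⟨0, by omega⟩, ⟨0, by omega⟩, by
    simp only [evenVertical]
    split_ifs <;> omega⟩
  top := Or.inr ⟨⟨m, by omega⟩, ⟨n, by omega⟩, by
    simp only [evenVertical]
    split_ifs <;> omega⟩

/-! ### The product of an even and an odd cycle -/

/-- The color of the edge from `j` to `j + 1` in both cycles of the prism `K₂ □ C_{2n+1}`. -/
def prismCycle (n j : ℕ) : ℕ :=
  if j < n then 2 * j + 2 else 4 * n + 1 - 2 * j

/-- The color of the rung of the prism `K₂ □ C_{2n+1}` over the vertex `j`. -/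
def prismRung (n j : ℕ) : ℕ :=
  if j = 0 then 0 else if j < n then 2 * j + 1 else 4 * n + 2 - 2 * j

/-- The lowest color at both vertices of the prism `K₂ □ C_{2n+1}` over `j`. -/
def prismLow (n j : ℕ) : ℕ :=
  if j ≤ n then 2 * j else 4 * n + 1 - 2 * j

/-- The colors of the horizontal edges of `C_{2m} □ C_{2n+1}`: rungs of the prism `i / 2` for even
`i`, and edges from that prism to the next one for odd `i`. The prism `b` is shifted by
`4 * min b (m - b)`, and `4 * min b (m - 1 - b)` is the smaller of the shifts of `b` and `b + 1`.
Prism colors start at `0`, torus colors at `1`. -/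
def oddHorizontal (m n i j : ℕ) : ℕ :=
  if i % 2 = 0 then prismRung n j + 4 * min (i / 2) (m - i / 2) + 1
  else prismLow n j + 4 * min (i / 2) (m - 1 - i / 2) + 4

/-- The colors of the vertical edges of `C_{2m} □ C_{2n+1}`. -/
def oddVertical (m n i j : ℕ) : ℕ :=
  prismCycle n j + 4 * min (i / 2) (m - i / 2) + 1

/-- The three colors at a vertex of the prism are consecutive, and `prismLow n j + 3` is the next
color. -/
theorem prism_consecutive {n j : ℕ} (hn : 1 ≤ n) (hj : j < 2 * n + 1) :
    AreConsecutive (prismLow n j) (prismRung n j) (prismLow n j + 3) (prismCycle n j)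
      (prismCycle n (if j = 0 then 2 * n + 1 - 1 else j - 1)) := by
  unfold AreConsecutive prismLow prismRung prismCycle
  split_ifs <;> omega

theorem prism_le {n j : ℕ} (hn : 1 ≤ n) (hj : j < 2 * n + 1) :
    prismLow n j ≤ 2 * n ∧ prismRung n j ≤ 2 * n + 2 ∧ prismCycle n j ≤ 2 * n + 1 := by
  unfold prismLow prismRung prismCycle
  split_ifs <;> omega

theorem oddTorusPattern {m n t : ℕ} (hm : 2 ≤ m) (hn : 1 ≤ n)
    (ht : t = if m % 2 = 0 then 2 * m + 2 * n + 3 else 2 * m + 2 * n + 2) [NeZero (2 * m)] :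
    IsTorusPattern (2 * m) (2 * n + 1) t (fun i j => oddHorizontal m n i j)
      (fun i j => oddVertical m n i j) where
  consecutive i j := by
    rw [Fin.val_cyclic_pred (by omega), Fin.val_cyclic_pred (by omega)]
    have hP := prism_consecutive hn j.isLt
    have hi := i.isLt
    generalize (i : ℕ) = i at *
    generalize (j : ℕ) = j at *
    simp only [oddHorizontal, oddVertical]
    generalize prismCycle n (if j = 0 then 2 * n + 1 - 1 else j - 1) = q at *
    generalize prismCycle n j = p at *
    generalize prismRung n j = r at *
    generalize prismLow n j = s at *
    unfold AreConsecutive at *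
    -- The edge from a vertex to another prism takes the color below the spectrum of the vertex in
    -- its own prism exactly when the other prism has a smaller shift.
    obtain ⟨b, rfl | rfl⟩ : ∃ b, i = 2 * b ∨ i = 2 * b + 1 := ⟨i / 2, by omega⟩
    · have h1 : 2 * b / 2 = b := by omega
      have h2 : 2 * b % 2 = 0 := by omega
      refine ⟨s + 4 * min b (m - b) + if b = 0 ∨ m < 2 * b then 1 else 0, ?_⟩
      rcases Nat.eq_zero_or_pos b with rfl | hb
      · have h3 : (2 * m - 1) % 2 = 1 := by omega
        have h4 : (2 * m - 1) / 2 = m - 1 := by omega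
        simp only [h3, h4, mul_zero, Nat.zero_mod, Nat.zero_div, if_true, one_ne_zero,
          if_false, true_or]
        omega
      · have h3 : (2 * b - 1) % 2 = 1 := by omega
        have h4 : (2 * b - 1) / 2 = b - 1 := by omega
        have h5 : 2 * b ≠ 0 := by omega
        simp only [h1, h2, h3, h4, h5, hb.ne', if_true, one_ne_zero, if_false, false_or]
        split_ifs <;> omega
    · have h1 : (2 * b + 1) / 2 = b := by omega
      have h2 : (2 * b + 1) % 2 = 1 := by omega
      have h3 : 2 * b / 2 = b := by omega
      have h4 : 2 * b % 2 = 0 := by omega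
      refine ⟨s + 4 * min b (m - b) + if 2 * b < m then 1 else 0, ?_⟩
      simp only [h1, h2, h3, h4, add_tsub_cancel_right, Nat.add_one_ne_zero, if_true,
        one_ne_zero, if_false]
      split_ifs <;> omega
  mem_H i j := by
    have := i.isLt
    have := prism_le hn j.isLt
    simp only [oddHorizontal]
    split_ifs at ht ⊢ <;> omega
  mem_V i j := by
    have := i.isLt
    have := prism_le hn j.isLt
    simp only [oddVertical]
    split_ifs at ht ⊢ <;> omega
  one := Or.inl ⟨⟨0, by omega⟩, ⟨0, by omega⟩, by simp [oddHorizontal, prismRung]⟩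
  top := Or.inl ⟨⟨m, by omega⟩, ⟨n, by omega⟩, by
    simp only [oddHorizontal, prismRung, prismLow]
    split_ifs at ht ⊢ <;> omega⟩

theorem corollary5 :
    (∀ m n t : ℕ, 2 ≤ m → 2 ≤ n → 4 ≤ t → t ≤ max (3 * m + n + 2) (3 * n + m + 2) →
      HasIntervalColoring (torus (2 * m) (2 * n)) t) ∧
    (∀ m n t : ℕ, 2 ≤ m → 1 ≤ n → Odd m → 4 ≤ t → t ≤ 2 * m + 2 * n + 2 →
      HasIntervalColoring (torus (2 * m) (2 * n + 1)) t) ∧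
    (∀ m n t : ℕ, 2 ≤ m → 1 ≤ n → Even m → 4 ≤ t → t ≤ 2 * m + 2 * n + 3 →
      HasIntervalColoring (torus (2 * m) (2 * n + 1)) t) := by
  refine ⟨fun m n t hm hn h4 ht => ?_, fun m n t hm hn hpar h4 ht => ?_,
    fun m n t hm hn hpar h4 ht => ?_⟩
  · have : NeZero (2 * m) := ⟨by omega⟩
    have : NeZero (2 * n) := ⟨by omega⟩
    rcases le_max_iff.mp ht with ht | ht
    · exact (evenTorusPattern hm hn).hasIntervalColoring (by omega) (by omega) h4 ht
    · exact (evenTorusPattern hn hm).swap.hasIntervalColoring (by omega) (by omega) h4 ht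
  · have : NeZero (2 * m) := ⟨by omega⟩
    rw [Nat.odd_iff] at hpar
    exact (oddTorusPattern hm hn (by rw [if_neg (by omega)])).hasIntervalColoring (by omega)
      (by omega) h4 ht
  · have : NeZero (2 * m) := ⟨by omega⟩
    rw [Nat.even_iff] at hpar
    exact (oddTorusPattern hm hn (by rw [if_pos hpar])).hasIntervalColoring (by omega)
      (by omega) h4 ht
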